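/- The game of Covering on a finite graph $G$ is played by a team of cops and a robber with perfect information. The cops first choose their starting vertices (several cops may share a vertex), then the robber chooses his starting vertex; after that the cops and the robber take turns, the cops moving first. On the cops' turn each cop stays put or moves to an adjacent vertex; on the robber's turn he moves to a vertex at graph distance at most $2$ from his current vertex. The cops win if they can ensure that after every one of their turns at least one cop is at the robber's vertex. Let $[n]^2$ be the graph on $\{1,\dots,n\}^2$ in which two distinct vertices are adjacent if and only if each of their coordinates differs by at most $1$, and let $C(n)$ be the least number of cops that can win Covering on $[n]^2$. **Theorem 1.1.** $C(n)=\Omega(n^{1.357})$. More precisely, for every real $f<\log_2\frac{1+\sqrt{17}}{2}$ there are $c>0$ and $N$ such that $C(n)\ge c\,n^{f}$ for all $n\ge N$; and $\log_2\frac{1+\sqrt{17}}{2}>1.357$. -/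

import Mathlib

namespace Covering

/-- The graph on `[n]²` in which two distinct vertices are adjacent when each
coordinate differs by at most `1`, so that graph distance is `ℓ_∞` distance.
The side `[n]` is `Fin n`. -/
def grid (n : ℕ) : SimpleGraph (Fin n × Fin n) where
  Adj u v := u ≠ v ∧ |(u.1 : ℤ) - (v.1 : ℤ)| ≤ 1 ∧ |(u.2 : ℤ) - (v.2 : ℤ)| ≤ 1
  symm := ⟨fun u v h => ⟨h.1.symm, by rw [abs_sub_comm]; exact h.2.1,
    by rw [abs_sub_comm]; exact h.2.2⟩⟩
  loopless := ⟨fun _ h => h.1 rfl⟩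

/-- A (deterministic, perfect information) strategy for `k` cops on `G`.

A history is the list of the robber's positions so far, the most recent one first.
`pos []` is the starting configuration, chosen before the robber chooses his starting
vertex; `pos (r :: h)` is the configuration after the cops' turn that answers the robber
being at `r`, when his earlier positions were `h`.
On each turn every cop stays put or moves to an adjacent vertex. -/
structure CopStrategy {V : Type*} (G : SimpleGraph V) (k : ℕ) where
  pos : List V → Fin k → V
  legal : ∀ (r : V) (h : List V) (i : Fin k),
    pos (r :: h) i = pos h i ∨ G.Adj (pos h i) (pos (r :: h) i)

/-- The histories that a robber of speed `s` can produce: he starts anywhere, and on each turn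
he moves to a vertex at distance at most `s` from his current one. -/
def IsRobberHistory {V : Type*} (G : SimpleGraph V) (s : ℕ) (h : List V) : Prop :=
  h.IsChain fun new old => G.edist old new ≤ (s : ℕ∞)

/-- The strategy wins: whatever the robber does, after every turn of the cops some cop is at
the robber's vertex. -/
def CopStrategy.IsWinning {V : Type*} {G : SimpleGraph V} {k : ℕ} (σ : CopStrategy G k)
    (s : ℕ) : Prop :=
  ∀ (r : V) (h : List V), IsRobberHistory G s (r :: h) → ∃ i, σ.pos (r :: h) i = r

/-- `k` cops can win Covering on `G` against a robber of speed `s`. -/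
def CopsWin {V : Type*} (G : SimpleGraph V) (s k : ℕ) : Prop :=
  ∃ σ : CopStrategy G k, σ.IsWinning s

/-- On a finite graph one (motionless) cop per vertex wins, so the infimum below is over a
nonempty set. -/
theorem copsWin_card {V : Type*} [Fintype V] (G : SimpleGraph V) (s : ℕ) :
    CopsWin G s (Fintype.card V) :=
  ⟨⟨fun _ => (Fintype.equivFin V).symm, fun _ _ _ => Or.inl rfl⟩,
    fun r _ _ => ⟨Fintype.equivFin V r, by simp⟩⟩

/-- The number of cops needed to win Covering on `G` against a robber of speed `s`: the least
`k` such that `k` cops can win. -/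
noncomputable def copsNeeded {V : Type*} (G : SimpleGraph V) (s : ℕ) : ℕ :=
  sInf {k | CopsWin G s k}

end Covering

namespace Covering

/-! The robber runs diagonally, two units per turn in each coordinate, so over `m` turns each cop
falls back by between `m` and `3 * m` in each coordinate relative to him. Let g(M) bound from below
the cops in each quadrant box of side M - 1 at the robber, and w(m) those passed in both coordinates
during a run of m turns. Comparing cops near the robber after m turns with their starting positions
gives w(2m) ≥ 2w(m) + 2g(m) (`CrossBound.double`) and g(4m) ≥ w(m) + 3g(m)
(`QuadrantBound.quadruple`). At m = 2 ^ i this system has growth rate x per doubling, where x² = x +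
4. -/

/-- A family of positions of a robber and of `k` cops (in integer coordinates) from which the cops
can keep covering a robber who moves two steps diagonally inside `[0, n)²`. -/
structure CoveredFamily (n k : ℕ) where
  mem : ℤ × ℤ → (Fin k → ℤ × ℤ) → Prop
  caught : ∀ r c, mem r c → ∃ i, c i = r
  step : ∀ r c, mem r c → ∀ a b : ℤ, |a| = 1 → |b| = 1 →
    0 ≤ r.1 + 2 * a → r.1 + 2 * a < n → 0 ≤ r.2 + 2 * b → r.2 + 2 * b < n →
    ∃ c', mem (r.1 + 2 * a, r.2 + 2 * b) c' ∧
      ∀ i, |(c' i).1 - (c i).1| ≤ 1 ∧ |(c' i).2 - (c i).2| ≤ 1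

/-- The `ℓ_∞` ball of radius `R` around `r` lies inside `[0, n)²`. -/
def HasRoom (n : ℕ) (R : ℤ) (r : ℤ × ℤ) : Prop :=
  R ≤ r.1 ∧ r.1 + R < n ∧ R ≤ r.2 ∧ r.2 + R < n

theorem HasRoom.mono {n : ℕ} {R R' : ℤ} {r : ℤ × ℤ} (h : HasRoom n R r) (hR : R' ≤ R) :
    HasRoom n R' r := by
  obtain ⟨h1, h2, h3, h4⟩ := h
  exact ⟨by omega, by omega, by omega, by omega⟩

theorem HasRoom.shift {n : ℕ} {R S : ℤ} {r : ℤ × ℤ} (h : HasRoom n R r) {a b : ℤ}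
    (ha : |a| = 1) (hb : |b| = 1) (hS : 0 ≤ S) :
    HasRoom n (R - S) (r.1 + S * a, r.2 + S * b) := by
  obtain ⟨h1, h2, h3, h4⟩ := h
  rcases eq_or_eq_neg_of_abs_eq ha with rfl | rfl <;>
    rcases eq_or_eq_neg_of_abs_eq hb with rfl | rfl <;>
    exact ⟨by simp only; omega, by simp only; omega, by simp only; omega, by simp only; omega⟩

/-- The cops in the open box of side `L` in the quadrant of direction `(a, b)` at `r`. -/
def quadrantCops {k : ℕ} (a b L : ℤ) (r : ℤ × ℤ) (c : Fin k → ℤ × ℤ) : Finset (Fin k) :=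
  {i | (1 ≤ a * ((c i).1 - r.1) ∧ a * ((c i).1 - r.1) ≤ L) ∧
    1 ≤ b * ((c i).2 - r.2) ∧ b * ((c i).2 - r.2) ≤ L}

/-- The cops that get from the open quadrant of direction `(a, b)` at the robber to the opposite
closed quadrant when the position changes from `(r, c)` to `(r', c')`. -/
def crossingCops {k : ℕ} (a b : ℤ) (r : ℤ × ℤ) (c : Fin k → ℤ × ℤ) (r' : ℤ × ℤ)
    (c' : Fin k → ℤ × ℤ) : Finset (Fin k) :=
  {i | (1 ≤ a * ((c i).1 - r.1) ∧ 1 ≤ b * ((c i).2 - r.2)) ∧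
    a * ((c' i).1 - r'.1) ≤ 0 ∧ b * ((c' i).2 - r'.2) ≤ 0}

/-! ### Recursive bounds for quadrant and crossing counts. -/

namespace CoveredFamily

variable {n k : ℕ} (W : CoveredFamily n k)

/-- Every position with enough room has at least `g` cops in each quadrant box of side `M - 1`. -/
def QuadrantBound (M : ℤ) (g : ℝ) : Prop :=
  ∀ a b : ℤ, |a| = 1 → |b| = 1 → ∀ r c, W.mem r c → HasRoom n M r →
    g ≤ (quadrantCops a b (M - 1) r c).card

/-- From every position with enough room, the robber can run diagonally for `m` turns so that
at least `w` cops are passed in both coordinates. -/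
def CrossBound (m : ℤ) (w : ℝ) : Prop :=
  ∀ a b : ℤ, |a| = 1 → |b| = 1 → ∀ r c, W.mem r c → HasRoom n (3 * m) r →
    ∃ c', W.mem (r.1 + 2 * m * a, r.2 + 2 * m * b) c' ∧
      (∀ i, |(c' i).1 - (c i).1| ≤ m ∧ |(c' i).2 - (c i).2| ≤ m) ∧
      w ≤ (crossingCops a b r c (r.1 + 2 * m * a, r.2 + 2 * m * b) c').card

variable {W}

theorem QuadrantBound.mono {M M' : ℤ} {g g' : ℝ} (h : W.QuadrantBound M g) (hM : M ≤ M')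
    (hg : g' ≤ g) : W.QuadrantBound M' g' := by
  intro a b ha hb r c hW hr
  refine (hg.trans (h a b ha hb r c hW (hr.mono hM))).trans ?_
  exact_mod_cast Finset.card_le_card fun i hi => by
    simp only [quadrantCops, Finset.mem_filter, Finset.mem_univ, true_and] at hi ⊢
    omega

theorem CrossBound.mono {m : ℤ} {w w' : ℝ} (h : W.CrossBound m w) (hw : w' ≤ w) :
    W.CrossBound m w' := by
  intro a b ha hb r c hW hr
  obtain ⟨c', h1, h2, h3⟩ := h a b ha hb r c hW hr
  exact ⟨c', h1, h2, hw.trans h3⟩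

theorem quadrantBound_zero (M : ℤ) : W.QuadrantBound M 0 :=
  fun _ _ _ _ _ _ _ _ => Nat.cast_nonneg _

theorem crossBound_one : W.CrossBound 1 0 := by
  intro a b ha hb r c hW hr
  obtain ⟨h1, h2, h3, h4⟩ := (hr.shift ha hb (S := 2) (by norm_num)).mono (R' := 0) (by norm_num)
  simp only at h1 h2 h3 h4
  obtain ⟨c', hc, hm⟩ := W.step r c hW a b ha hb (by linarith) (by linarith) (by linarith)
    (by linarith)
  exact ⟨c', by simpa using hc, hm, Nat.cast_nonneg _⟩

/-- Some cop must catch the robber after one diagonal turn; just before, its offset was between 1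
and 3 in both coordinates. -/
theorem quadrantBound_four : W.QuadrantBound 4 1 := by
  intro a b ha hb r c hW hr
  obtain ⟨h1, h2, h3, h4⟩ := (hr.shift ha hb (S := 2) (by norm_num)).mono (R' := 0) (by norm_num)
  simp only at h1 h2 h3 h4
  obtain ⟨c', hc, hm⟩ := W.step r c hW a b ha hb (by linarith) (by linarith) (by linarith)
    (by linarith)
  obtain ⟨i, hi⟩ := W.caught _ _ hc
  obtain ⟨hx, hy⟩ := hm i
  rw [hi] at hx hy
  rw [abs_le] at hx hy
  have : i ∈ quadrantCops a b (4 - 1) r c := by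
    simp only [quadrantCops, Finset.mem_filter, Finset.mem_univ, true_and]
    rcases eq_or_eq_neg_of_abs_eq ha with rfl | rfl <;>
      rcases eq_or_eq_neg_of_abs_eq hb with rfl | rfl <;> simp only at hx hy ⊢ <;> omega
  exact_mod_cast Finset.card_pos.2 ⟨i, this⟩

theorem card_add_four_le {ι : Type*} {A B C D U : Finset ι}
    (hU : ∀ i, i ∈ A ∨ i ∈ B ∨ i ∈ C ∨ i ∈ D → i ∈ U)
    (hAB : ∀ i, i ∈ A → i ∉ B) (hAC : ∀ i, i ∈ A → i ∉ C) (hAD : ∀ i, i ∈ A → i ∉ D)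
    (hBC : ∀ i, i ∈ B → i ∉ C) (hBD : ∀ i, i ∈ B → i ∉ D) (hCD : ∀ i, i ∈ C → i ∉ D) :
    A.card + B.card + C.card + D.card ≤ U.card := by
  classical
  have h1 : Disjoint A B := Finset.disjoint_left.2 hAB
  have h2 : Disjoint (A ∪ B) C := by
    simp only [Finset.disjoint_left, Finset.mem_union]; rintro i (h | h)
    exacts [hAC i h, hBC i h]
  have h3 : Disjoint (A ∪ B ∪ C) D := by
    simp only [Finset.disjoint_left, Finset.mem_union]; rintro i ((h | h) | h)
    exacts [hAD i h, hBD i h, hCD i h]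
  rw [← Finset.card_union_of_disjoint h1, ← Finset.card_union_of_disjoint h2,
    ← Finset.card_union_of_disjoint h3]
  exact Finset.card_le_card fun i hi => hU i (by simpa [or_assoc] using hi)

/-- Halfway through a run of `2 * m` turns, the cops that are passed in exactly one coordinate and
are close to the robber cross neither in the first half nor in the second half. -/
theorem CrossBound.double {m : ℤ} {w g : ℝ} (hm : 1 ≤ m) (hw : W.CrossBound m w)
    (hg : W.QuadrantBound m g) : W.CrossBound (2 * m) (2 * w + 2 * g) := by
  intro a b ha hb r c hW hr
  obtain ⟨c₁, hW₁, hd₁, hw₁⟩ := hw a b ha hb r c hW (hr.mono (by linarith))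
  have hr₁ := hr.shift ha hb (S := 2 * m) (by linarith)
  obtain ⟨c₂, hW₂, hd₂, hw₂⟩ := hw a b ha hb _ c₁ hW₁ (hr₁.mono (by linarith))
  have hp := hg a (-b) ha (by simpa using hb) _ c₁ hW₁ (hr₁.mono (by linarith))
  have hq := hg (-a) b (by simpa using ha) hb _ c₁ hW₁ (hr₁.mono (by linarith))
  have e1 : r.1 + 2 * m * a + 2 * m * a = r.1 + 2 * (2 * m) * a := by ring
  have e2 : r.2 + 2 * m * b + 2 * m * b = r.2 + 2 * (2 * m) * b := by ring
  simp only [e1, e2] at hW₂ hw₂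
  refine ⟨c₂, hW₂, fun i => ?_, ?_⟩
  · have h1 := hd₁ i
    have h2 := hd₂ i
    simp only [abs_le] at h1 h2 ⊢
    omega
  have key := card_add_four_le
    (A := crossingCops a b r c (r.1 + 2 * m * a, r.2 + 2 * m * b) c₁)
    (B := crossingCops a b (r.1 + 2 * m * a, r.2 + 2 * m * b) c₁
      (r.1 + 2 * (2 * m) * a, r.2 + 2 * (2 * m) * b) c₂)
    (C := quadrantCops a (-b) (m - 1) (r.1 + 2 * m * a, r.2 + 2 * m * b) c₁)
    (D := quadrantCops (-a) b (m - 1) (r.1 + 2 * m * a, r.2 + 2 * m * b) c₁)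
    (U := crossingCops a b r c (r.1 + 2 * (2 * m) * a, r.2 + 2 * (2 * m) * b) c₂)
    -- A mid-run offset of absolute value at most `m - 1` was at least 1 before the first half and
    -- is at most -1 after the second. This is why the boxes have side `m - 1`.
    (by
      intro i
      have h1 := hd₁ i
      have h2 := hd₂ i
      simp only [crossingCops, quadrantCops, Finset.mem_filter, Finset.mem_univ, true_and]
      simp only [abs_le] at h1 h2
      rcases eq_or_eq_neg_of_abs_eq ha with rfl | rfl <;>
        rcases eq_or_eq_neg_of_abs_eq hb with rfl | rfl <;> omega)
    (by intro i; simp only [crossingCops, Finset.mem_filter, Finset.mem_univ, true_and]; omega)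
    (by
      intro i
      simp only [crossingCops, quadrantCops, Finset.mem_filter, Finset.mem_univ, true_and]; omega)
    (by
      intro i
      simp only [crossingCops, quadrantCops, Finset.mem_filter, Finset.mem_univ, true_and]; omega)
    (by
      intro i
      simp only [crossingCops, quadrantCops, Finset.mem_filter, Finset.mem_univ, true_and,
        neg_mul]; omega)
    (by
      intro i
      simp only [crossingCops, quadrantCops, Finset.mem_filter, Finset.mem_univ, true_and,
        neg_mul]; omega)
    (by
      intro i
      simp only [quadrantCops, Finset.mem_filter, Finset.mem_univ, true_and, neg_mul]; omega)
  have key' := (Nat.cast_le (α := ℝ)).2 key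
  push_cast at key'
  linarith

/-- After a run of `m` turns, the nearby cops that are not passed in both coordinates were all in
the quadrant box of side `4 * m - 1` at the start, and they did not cross. -/
theorem QuadrantBound.quadruple {m : ℤ} {w g : ℝ} (hm : 1 ≤ m) (hw : W.CrossBound m w)
    (hg : W.QuadrantBound m g) : W.QuadrantBound (4 * m) (w + 3 * g) := by
  intro a b ha hb r c hW hr
  obtain ⟨c₁, hW₁, hd₁, hw₁⟩ := hw a b ha hb r c hW (hr.mono (by linarith))
  have hr₁ := hr.shift ha hb (S := 2 * m) (by linarith)
  have ho := hg a b ha hb _ c₁ hW₁ (hr₁.mono (by linarith))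
  have hp := hg a (-b) ha (by simpa using hb) _ c₁ hW₁ (hr₁.mono (by linarith))
  have hq := hg (-a) b (by simpa using ha) hb _ c₁ hW₁ (hr₁.mono (by linarith))
  have key := card_add_four_le
    (A := crossingCops a b r c (r.1 + 2 * m * a, r.2 + 2 * m * b) c₁)
    (B := quadrantCops a b (m - 1) (r.1 + 2 * m * a, r.2 + 2 * m * b) c₁)
    (C := quadrantCops a (-b) (m - 1) (r.1 + 2 * m * a, r.2 + 2 * m * b) c₁)
    (D := quadrantCops (-a) b (m - 1) (r.1 + 2 * m * a, r.2 + 2 * m * b) c₁)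
    (U := quadrantCops a b (4 * m - 1) r c)
    -- A final offset in `[-(m - 1), m - 1]` started in `[1, 4 * m - 1]`; a crossing cop started at
    -- most `3 * m` ahead.
    (by
      intro i
      have h1 := hd₁ i
      simp only [crossingCops, quadrantCops, Finset.mem_filter, Finset.mem_univ, true_and]
      simp only [abs_le] at h1
      rcases eq_or_eq_neg_of_abs_eq ha with rfl | rfl <;>
        rcases eq_or_eq_neg_of_abs_eq hb with rfl | rfl <;> omega)
    (by
      intro i
      simp only [crossingCops, quadrantCops, Finset.mem_filter, Finset.mem_univ, true_and]; omega)
    (by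
      intro i
      simp only [crossingCops, quadrantCops, Finset.mem_filter, Finset.mem_univ, true_and]; omega)
    (by
      intro i
      simp only [crossingCops, quadrantCops, Finset.mem_filter, Finset.mem_univ, true_and]; omega)
    (by
      intro i
      simp only [quadrantCops, Finset.mem_filter, Finset.mem_univ, true_and, neg_mul]; omega)
    (by
      intro i
      simp only [quadrantCops, Finset.mem_filter, Finset.mem_univ, true_and, neg_mul]; omega)
    (by
      intro i
      simp only [quadrantCops, Finset.mem_filter, Finset.mem_univ, true_and, neg_mul]; omega)
  have key' := (Nat.cast_le (α := ℝ)).2 key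
  push_cast at key'
  linarith

theorem crossBound_eight : W.CrossBound 8 2 := by
  have h2 := (crossBound_one (W := W)).double le_rfl (quadrantBound_zero 1)
  have h4 := h2.double (by norm_num) (quadrantBound_zero _)
  have h8 := h4.double (by norm_num) (g := 1) (by norm_num; exact quadrantBound_four)
  norm_num at h8
  exact h8

/-- The pair `(1, x + 1)` is an eigenvector of the recursion: `x ^ 2 = (x + 1) + 3` and `(x + 1) * x
= 2 * (x + 1) + 2`. Two consecutive scales of the quadrant bound are carried because `quadruple`
skips one. -/
theorem bounds_two_pow {x : ℝ} (hx : x ^ 2 = x + 4) (h5 : x ≤ 5) (j : ℕ) :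
    W.QuadrantBound (2 ^ (j + 4)) (x ^ j) ∧ W.QuadrantBound (2 ^ (j + 5)) (x ^ (j + 1)) ∧
      W.CrossBound (2 ^ (j + 4)) ((x + 1) * x ^ j) := by
  induction j with
  | zero =>
    have h8 := (quadrantBound_four (W := W)).mono (M' := 8) (by norm_num) le_rfl
    refine ⟨?_, ?_, ?_⟩
    · exact (quadrantBound_four (W := W)).mono (by norm_num) (by simp)
    -- The value obtained is 2 + 3 · 1 = 5, whence the hypothesis `x ≤ 5`.
    · have := QuadrantBound.quadruple (by norm_num) (crossBound_eight (W := W)) h8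
      exact this.mono (by norm_num) (by norm_num; linarith)
    · have := (crossBound_eight (W := W)).double (by norm_num) h8
      norm_num at this ⊢
      exact this.mono (by linarith)
  | succ j ih =>
    obtain ⟨h1, h3, h4⟩ := ih
    have hm : (1 : ℤ) ≤ 2 ^ (j + 4) := one_le_pow₀ (by norm_num)
    have e : ∀ i, x ^ (i + 2) = x ^ (i + 1) + 4 * x ^ i := fun i => by
      rw [pow_add, hx]; ring
    refine ⟨by convert h3 using 2, ?_, ?_⟩
    · refine (QuadrantBound.quadruple hm h4 h1).mono (by rw [pow_add, pow_add]; omega) (le_of_eq ?_)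
      rw [show j + 1 + 1 = j + 2 from rfl, e]; ring
    · convert (h4.double hm h1).mono (le_of_eq ?_) using 1
      · ring
      · have := e j
        linear_combination this

end CoveredFamily

/-! ### From strategies on the grid to integer positions. -/

theorem grid_edist_le_two {n : ℕ} {u v : Fin n × Fin n} {a b : ℤ} (ha : |a| = 1) (hb : |b| = 1)
    (h1 : (v.1 : ℤ) = u.1 + 2 * a) (h2 : (v.2 : ℤ) = u.2 + 2 * b) :
    (grid n).edist u v ≤ (2 : ℕ) := by
  have hu1 := u.1.isLt
  have hu2 := u.2.isLt
  have hv1 := v.1.isLt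
  have hv2 := v.2.isLt
  have hx : 0 ≤ (u.1 : ℤ) + a ∧ (u.1 : ℤ) + a < n := by
    rcases eq_or_eq_neg_of_abs_eq ha with rfl | rfl <;> omega
  have hy : 0 ≤ (u.2 : ℤ) + b ∧ (u.2 : ℤ) + b < n := by
    rcases eq_or_eq_neg_of_abs_eq hb with rfl | rfl <;> omega
  obtain ⟨x, hx'⟩ := Int.eq_ofNat_of_zero_le hx.1
  obtain ⟨y, hy'⟩ := Int.eq_ofNat_of_zero_le hy.1
  let w : Fin n × Fin n := (⟨x, by omega⟩, ⟨y, by omega⟩)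
  have hw1 : (w.1 : ℤ) = u.1 + a := hx'.symm
  have hw2 : (w.2 : ℤ) = u.2 + b := hy'.symm
  have ha0 : a ≠ 0 := by rintro rfl; simp at ha
  have hvw : (grid n).Adj v w := by
    refine ⟨?_, ?_, ?_⟩
    · intro h
      rw [h] at h1
      omega
    · rw [h1, hw1, show (u.1 : ℤ) + 2 * a - (u.1 + a) = a by ring, ha]
    · rw [h2, hw2, show (u.2 : ℤ) + 2 * b - (u.2 + b) = b by ring, hb]
  have hwu : (grid n).Adj w u := by
    refine ⟨?_, ?_, ?_⟩
    · intro h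
      rw [h] at hw1
      omega
    · rw [hw1, add_sub_cancel_left, ha]
    · rw [hw2, add_sub_cancel_left, hb]
  exact (SimpleGraph.Walk.cons hwu.symm
    (SimpleGraph.Walk.cons hvw.symm SimpleGraph.Walk.nil)).edist_le

/-- The integer coordinates of a vertex of the grid. -/
def gridCoord {n : ℕ} (v : Fin n × Fin n) : ℤ × ℤ := ((v.1 : ℤ), (v.2 : ℤ))

theorem gridCoord_le_one {n : ℕ} {u v : Fin n × Fin n} (h : v = u ∨ (grid n).Adj u v) :
    |(gridCoord v).1 - (gridCoord u).1| ≤ 1 ∧ |(gridCoord v).2 - (gridCoord u).2| ≤ 1 := by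
  rcases h with rfl | h
  · simp
  · exact ⟨by rw [abs_sub_comm]; exact h.2.1, by rw [abs_sub_comm]; exact h.2.2⟩

/-- The positions that a winning strategy on the grid can reach. -/
def CopStrategy.IsWinning.coveredFamily {n k : ℕ} {σ : CopStrategy (grid n) k}
    (hσ : σ.IsWinning 2) : CoveredFamily n k where
  mem r c := ∃ v h, IsRobberHistory (grid n) 2 (v :: h) ∧ r = gridCoord v ∧
    c = fun i => gridCoord (σ.pos (v :: h) i)
  caught := by
    rintro _ _ ⟨v, h, hh, rfl, rfl⟩
    obtain ⟨i, hi⟩ := hσ v h hh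
    exact ⟨i, by simp only [hi]⟩
  step := by
    rintro _ _ ⟨v, h, hh, rfl, rfl⟩ a b ha hb h1 h2 h3 h4
    obtain ⟨x, hx⟩ := Int.eq_ofNat_of_zero_le h1
    obtain ⟨y, hy⟩ := Int.eq_ofNat_of_zero_le h3
    let v' : Fin n × Fin n := (⟨x, by omega⟩, ⟨y, by omega⟩)
    refine ⟨fun i => gridCoord (σ.pos (v' :: v :: h) i), ⟨v', v :: h, ?_, ?_, rfl⟩,
      fun i => gridCoord_le_one (σ.legal v' (v :: h) i)⟩
    · exact List.IsChain.cons_cons (grid_edist_le_two ha hb hx.symm hy.symm) hh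
    · exact Prod.ext hx hy

/-! ### The lower bound and its exponent. -/

theorem pow_le_of_copsWin {x : ℝ} (hx : x ^ 2 = x + 4) (h5 : x ≤ 5) {n j k : ℕ}
    (hn : 2 ^ (j + 5) < n) (hk : CopsWin (grid n) 2 k) : x ^ j ≤ k := by
  obtain ⟨σ, hσ⟩ := hk
  have hp : 2 ^ (j + 5) = 2 * 2 ^ (j + 4) := by ring
  let v : Fin n × Fin n := (⟨2 ^ (j + 4), by omega⟩, ⟨2 ^ (j + 4), by omega⟩)
  have hq := (CoveredFamily.bounds_two_pow (W := hσ.coveredFamily) hx h5 j).1 1 1 (by simp)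
    (by simp) (gridCoord v) (fun i => gridCoord (σ.pos [v] i))
    ⟨v, [], List.IsChain.singleton v, rfl, rfl⟩ (by
      have : ((2 ^ (j + 4) : ℕ) : ℤ) = 2 ^ (j + 4) := by push_cast; rfl
      simp only [HasRoom, gridCoord, v]
      omega)
  refine hq.trans ?_
  exact_mod_cast (Finset.card_le_univ _).trans (by simp)

theorem exists_mul_rpow_le_copsNeeded {x : ℝ} (hx : x ^ 2 = x + 4) (h2 : 2 ≤ x) (h5 : x ≤ 5)
    {f : ℝ} (hf : f ≤ Real.logb 2 x) :
    ∃ c : ℝ, 0 < c ∧ ∃ N : ℕ, ∀ n : ℕ, N ≤ n → c * (n : ℝ) ^ f ≤ copsNeeded (grid n) 2 := by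
  have hx0 : 0 < x := by linarith
  have hlog : 0 ≤ Real.logb 2 x := Real.logb_nonneg (by norm_num) (by linarith)
  -- With `2 ^ (j + 6) ≤ n < 2 ^ (j + 7)`, the bound `x ^ j` loses at most a factor `x ^ 7`.
  refine ⟨(x ^ 7)⁻¹, by positivity, 2 ^ 6, fun n hn => ?_⟩
  have hn0 : n ≠ 0 := by rintro rfl; norm_num at hn
  obtain ⟨j, hj⟩ : ∃ j, Nat.log 2 n = j + 6 :=
    ⟨Nat.log 2 n - 6, by have := (Nat.le_log_iff_pow_le (by norm_num) hn0).2 hn; omega⟩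
  have hlo : 2 ^ (j + 6) ≤ n := hj ▸ Nat.pow_log_le_self 2 hn0
  have hhi : n < 2 ^ (j + 7) := by
    have := Nat.lt_pow_succ_log_self (b := 2) (by norm_num) n
    rwa [hj] at this
  have hlt : 2 ^ (j + 5) < n :=
    lt_of_lt_of_le (Nat.pow_lt_pow_right (by norm_num) (by omega)) hlo
  have hmem : CopsWin (grid n) 2 (copsNeeded (grid n) 2) :=
    Nat.sInf_mem (s := {k | CopsWin (grid n) 2 k}) ⟨_, copsWin_card (grid n) 2⟩
  refine le_trans ?_ (pow_le_of_copsWin hx h5 hlt hmem)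
  rw [inv_mul_le_iff₀ (by positivity), ← pow_add, add_comm 7 j]
  have hn1 : (1 : ℝ) ≤ n := by exact_mod_cast Nat.one_le_iff_ne_zero.2 hn0
  calc (n : ℝ) ^ f ≤ (n : ℝ) ^ Real.logb 2 x := Real.rpow_le_rpow_of_exponent_le hn1 hf
    _ ≤ ((2 : ℝ) ^ (j + 7)) ^ Real.logb 2 x :=
      Real.rpow_le_rpow (by positivity) (by exact_mod_cast hhi.le) hlog
    _ = x ^ (j + 7) := by
      rw [← Real.rpow_natCast, ← Real.rpow_mul (by norm_num), mul_comm, Real.rpow_mul (by norm_num),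
        Real.rpow_logb (by norm_num) (by norm_num) hx0, Real.rpow_natCast]

set_option exponentiation.threshold 2000 in
theorem lt_logb_two_root : (1.357 : ℝ) < Real.logb 2 ((1 + Real.sqrt 17) / 2) := by
  have hs : (4.1231 : ℝ) < Real.sqrt 17 := Real.lt_sqrt_of_sq_lt (by norm_num)
  have hb : (2.56155 : ℝ) ≤ (1 + Real.sqrt 17) / 2 := by linarith
  refine lt_of_lt_of_le ?_ (Real.logb_le_logb_of_le (by norm_num) (by norm_num) hb)
  rw [Real.lt_logb_iff_rpow_lt (by norm_num) (by norm_num)]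
  -- The 1000th power clears the denominator of 1.357, leaving a rational inequality.
  refine lt_of_pow_lt_pow_left₀ 1000 (by norm_num) ?_
  rw [← Real.rpow_natCast, ← Real.rpow_mul (by norm_num),
    show (1.357 : ℝ) * (1000 : ℕ) = (1357 : ℕ) by norm_num, Real.rpow_natCast]
  norm_num

end Covering

theorem theorem1p1 :
    (∃ c : ℝ, 0 < c ∧ ∃ N : ℕ, ∀ n : ℕ, N ≤ n →
      c * (n : ℝ) ^ (1.357 : ℝ) ≤ (Covering.copsNeeded (Covering.grid n) 2 : ℝ)) ∧
    (∀ f : ℝ, f < Real.logb 2 ((1 + Real.sqrt 17) / 2) →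
      ∃ c : ℝ, 0 < c ∧ ∃ N : ℕ, ∀ n : ℕ, N ≤ n →
        c * (n : ℝ) ^ f ≤ (Covering.copsNeeded (Covering.grid n) 2 : ℝ)) ∧
    (1.357 : ℝ) < Real.logb 2 ((1 + Real.sqrt 17) / 2) := by
  have hs : Real.sqrt 17 ^ 2 = 17 := Real.sq_sqrt (by norm_num)
  have h3 : (3 : ℝ) ≤ Real.sqrt 17 := Real.le_sqrt_of_sq_le (by norm_num)
  have h9 : Real.sqrt 17 ≤ 9 := Real.sqrt_le_iff.2 ⟨by norm_num, by norm_num⟩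
  have key : ∀ f : ℝ, f < Real.logb 2 ((1 + Real.sqrt 17) / 2) →
      ∃ c : ℝ, 0 < c ∧ ∃ N : ℕ, ∀ n : ℕ, N ≤ n →
        c * (n : ℝ) ^ f ≤ (Covering.copsNeeded (Covering.grid n) 2 : ℝ) := fun f hf =>
    Covering.exists_mul_rpow_le_copsNeeded (by linear_combination hs / 4) (by linarith)
      (by linarith) hf.le
  exact ⟨key _ Covering.lt_logb_two_root, key, Covering.lt_logb_two_root⟩
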